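/- \textbf{Slicing inequality.} Let $\alpha_k$ be the Lebesgue measure of the unit ball of $\mathbb{R}^k$ ($\alpha_0=1$), and let $\mathcal{S}^k$ denote the normalized $k$-dimensional Hausdorff spherical (outer) measure on $\mathbb{R}^n$, \[ \mathcal{S}^k(A)=\lim_{\delta\to 0}\ \inf\Big\{\sum_i \alpha_k r_i^k \;:\; A\subset \bigcup_i \bar B(p_i,r_i),\ \operatorname{diam}\bar B(p_i,r_i)\le\delta\Big\}, \] the infimum being over countable (possibly finite or empty) coverings by closed balls, with $0^0=1$. A set or function is called $\mathcal{S}^k$ measurable if it is measurable in the sense of Carath\'eodory for this outer measure. Let $m\geq 1$ and $0\le M\le n-1$ be integers. Suppose $X\subset\mathbb{R}^n$ is $\mathcal{S}^m$ measurable with $\mathcal{S}^m(X)<\infty$, and $f:X\to\mathbb{R}$ is $\mathcal{S}^m$ measurable, non-negative and bounded. Let $E$ be an $M$-dimensional affine subspace of $\mathbb{R}^n$, and for $t>0$ let $X_t$ denote the set of points of $X$ at distance $t$ from $E$. Then for Lebesgue almost every $t>0$ the set $X_t$ and the function $f|_{X_t}$ are $\mathcal{S}^{m-1}$ measurable, the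 function $t\mapsto\int_{X_t} f\,d\mathcal{S}^{m-1}\in[0,\infty]$, which is thus defined for almost every $t>0$, is Lebesgue measurable, and \[ \int_0^\infty\int_{X_t} f(q)\,d\mathcal{S}^{m-1}(q)\,dt\ \le\ \int_X f(q)\,d\mathcal{S}^m(q). \] -/

import Mathlib

open MeasureTheory Set
open scoped ENNReal NNReal

namespace Slicing

noncomputable section

/-- The Lebesgue measure of the unit ball of `ℝᵐ`. -/
def unitBallVolume (m : ℕ) : ℝ≥0∞ :=
  volume (Metric.closedBall (0 : EuclideanSpace ℝ (Fin m)) 1)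

/-- The gauge `α_m rᵐ` of a closed ball of radius `r`; it is `∞` on sets that are not closed balls,
so that only closed balls are admitted in coverings. -/
def ballGauge {E : Type*} [PseudoMetricSpace E] (m : ℕ) (s : Set E) : ℝ≥0∞ :=
  ⨅ (c : E) (r : ℝ≥0) (_ : s = Metric.closedBall c (r : ℝ)), unitBallVolume m * (r : ℝ≥0∞) ^ m

/-- The (normalized) `m`-dimensional Hausdorff spherical measure, as an outer measure:
the limit as `δ → 0` of the infima of `∑ α_m rᵢᵐ` over countable coverings by closed balls
of diameter at most `δ`. -/
def sphericalMeasure (E : Type*) [MetricSpace E] (m : ℕ) : OuterMeasure E :=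
  OuterMeasure.mkMetric' (ballGauge m)

/-- `f` restricted to `X` is a `μ`-measurable function on a `μ`-measurable set,
in the sense of Carathéodory. -/
def IsMeasurableOn {α : Type*} (μ : OuterMeasure α) (X : Set α) (f : α → ℝ) : Prop :=
  μ.IsCaratheodory X ∧ ∀ U : Set ℝ, MeasurableSet U → μ.IsCaratheodory (X ∩ f ⁻¹' U)

/-- The integral `∫_X f dμ` of a function `f` which is non-negative on `X`, with respect to the
measure that the outer measure `μ` induces on its Carathéodory measurable sets. -/
def integralOn {α : Type*} (μ : OuterMeasure α) (X : Set α) (f : α → ℝ) : ℝ≥0∞ :=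
  letI : MeasurableSpace α := μ.caratheodory
  ∫⁻ q in X, ENNReal.ofReal (f q) ∂(μ.toMeasure le_rfl)

/-- The points of `X` at distance `t` from `P`. -/
def slice {E : Type*} [PseudoMetricSpace E] (X P : Set E) (t : ℝ) : Set E :=
  {x ∈ X | Metric.infDist x P = t}

end

end Slicing

namespace Slicing

open OuterMeasure Metric Filter Topology

/-! Cover the part of `X` farther than `ε` from `P` by small balls whose gauges add up to little
more than the measure of `X`. For a ball of radius `r` with centre at distance `d` from `P`, the
slice at distance `t` is nearly flat: up to a factor tending to 1 with the radius, it fits into a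
ball of radius `√(r² - (t - d)²)` (`exists_dist_sq_le_of_infDist_eq`). By Cavalieri the gauges of
these balls, one dimension lower, integrate over `t` to exactly the gauge of the original ball
(`lintegral_sectionVolume`). Summation and Fatou's lemma then bound the slice measures by a
measurable function with the right integral (`exists_measurable_slice_bound`). This holds for
arbitrary sets, so null sets have null slices for almost every `t`.

For measurability, `X` is an increasing union of compact sets up to a null set
(`exists_compact_exhaustion`). On a compact set, outer regularity by open sets makes the slice
measure a supremum of upper semicontinuous functions of `t`
(`measurable_sphericalMeasure_levelSet`). Functions are reached from indicators by sums and
increasing limits (`slicing_ennreal`). -/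

theorem unitBallVolume_ne_top (k : ℕ) : unitBallVolume k ≠ ∞ :=
  measure_closedBall_lt_top.ne

theorem ballGauge_closedBall_le {E : Type*} [PseudoMetricSpace E] (k : ℕ) (c : E) (r : ℝ≥0) :
    ballGauge k (closedBall c (r : ℝ)) ≤ unitBallVolume k * (r : ℝ≥0∞) ^ k :=
  iInf_le_of_le c <| iInf_le_of_le r <| iInf_le_of_le rfl le_rfl

/-! ### Coverings by balls, Borel hulls and compact exhaustion -/

section Covers

variable {E : Type*} [MetricSpace E]

/-- Near-optimal coverings by closed balls, all of which meet the covered set. -/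
theorem exists_cover_of_pre_lt {k : ℕ} {δ c : ℝ≥0∞} {A : Set E}
    (h : mkMetric'.pre (ballGauge k) δ A < c) :
    ∃ (I : Set ℕ) (p : I → E) (r : I → ℝ≥0), A ⊆ ⋃ i, closedBall (p i) (r i) ∧
      (∀ i, (closedBall (p i) (r i : ℝ) ∩ A).Nonempty) ∧
      (∀ i, ediam (closedBall (p i) (r i : ℝ)) ≤ δ) ∧
      ∑' i, unitBallVolume k * (r i : ℝ≥0∞) ^ k < c := by
  rw [mkMetric'.pre, boundedBy_apply] at h
  simp only [iInf_lt_iff] at h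
  obtain ⟨t, hA, hsum⟩ := h
  obtain ⟨e, he0, he⟩ := ENNReal.lt_iff_exists_add_pos_lt.1 hsum
  obtain ⟨ε, hε0, hε⟩ := ENNReal.exists_pos_sum_of_countable
    (ENNReal.coe_pos.2 he0).ne' ℕ
  -- Empty sets of the covering cost nothing here, even for `k = 0`. Keeping only the sets that meet
  -- `A` discards them; the slack `ε i` is spent because the gauge is an infimum over centres and
  -- radii.
  set w : ℕ → ℝ≥0∞ := fun n => ⨆ (_ : (t n).Nonempty),
    extend (fun s (_ : ediam s ≤ δ) => ballGauge k s) (t n) with hw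
  have key : ∀ i : {n | (t n ∩ A).Nonempty}, ∃ (p : E) (r : ℝ≥0),
      t i = closedBall p (r : ℝ) ∧ ediam (t i) ≤ δ ∧
        unitBallVolume k * (r : ℝ≥0∞) ^ k ≤ w i + ε i := by
    rintro ⟨n, hn⟩
    have hne : (t n).Nonempty := hn.mono inter_subset_left
    have hwn : w n = extend (fun s (_ : ediam s ≤ δ) => ballGauge k s) (t n) := by
      simp [hw, hne]
    have hlt : w n < ∞ := (ENNReal.le_tsum n).trans_lt (hsum.trans_le le_top)
    have hd : ediam (t n) ≤ δ := by
      by_contra hd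
      rw [hwn, extend, iInf_neg hd] at hlt
      exact lt_irrefl _ hlt
    rw [extend, iInf_pos hd] at hwn
    have h2 : ballGauge k (t n) < w n + ε n := by
      rw [← hwn]
      exact ENNReal.lt_add_right hlt.ne (ENNReal.coe_pos.2 (hε0 n)).ne'
    simp only [ballGauge, iInf_lt_iff] at h2
    obtain ⟨p, r, hpr, hlt2⟩ := h2
    exact ⟨p, r, hpr, hd, hlt2.le⟩
  choose p r hpr hd hle using key
  refine ⟨_, p, r, ?_, fun i => by rw [← hpr]; exact i.2, fun i => by rw [← hpr]; exact hd i, ?_⟩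
  · intro x hx
    obtain ⟨n, hn⟩ := mem_iUnion.1 (hA hx)
    refine mem_iUnion.2 ⟨⟨n, x, hn, hx⟩, ?_⟩
    rw [← hpr]
    exact hn
  · calc ∑' i, unitBallVolume k * (r i : ℝ≥0∞) ^ k
        ≤ ∑' i : {n | (t n ∩ A).Nonempty}, (w i + ε i) := ENNReal.tsum_le_tsum hle
      _ ≤ ∑' n, (w n + ε n) := ENNReal.tsum_comp_le_tsum_of_injective Subtype.val_injective _
      _ = ∑' n, w n + ∑' n, (ε n : ℝ≥0∞) := ENNReal.tsum_add
      _ ≤ ∑' n, w n + e := by gcongr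
      _ < c := he

theorem pre_le_tsum_of_cover {ι : Type*} [Countable ι] (k : ℕ) {δ : ℝ≥0∞} {A : Set E}
    (p : ι → E) (r : ι → ℝ≥0) (hA : A ⊆ ⋃ i, closedBall (p i) (r i))
    (hd : ∀ i, ediam (closedBall (p i) (r i : ℝ)) ≤ δ) :
    mkMetric'.pre (ballGauge k) δ A ≤ ∑' i, unitBallVolume k * (r i : ℝ≥0∞) ^ k :=
  (measure_mono hA).trans <| (measure_iUnion_le _).trans <| ENNReal.tsum_le_tsum fun i =>
    (mkMetric'.pre_le (hd i)).trans (ballGauge_closedBall_le k _ _)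

theorem pre_le_sphericalMeasure (k : ℕ) {δ : ℝ≥0∞} (hδ : 0 < δ) (A : Set E) :
    mkMetric'.pre (ballGauge k) δ A ≤ sphericalMeasure E k A := by
  have : mkMetric'.pre (ballGauge k) δ ≤ sphericalMeasure E k :=
    le_iSup₂ (f := fun (r : ℝ≥0∞) (_ : r > 0) => mkMetric'.pre (ballGauge (E := E) k) r) δ hδ
  exact this A

theorem sphericalMeasure_le_of_forall_pre_le {k : ℕ} {A : Set E} {c : ℝ≥0∞}
    (h : ∀ j : ℕ, mkMetric'.pre (ballGauge k) (j : ℝ≥0∞)⁻¹ A ≤ c) :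
    sphericalMeasure E k A ≤ c := by
  rw [sphericalMeasure, mkMetric'.eq_iSup_nat, iSup_apply]
  exact iSup_le h

theorem borel_le_caratheodory_sphericalMeasure (k : ℕ) :
    borel E ≤ (sphericalMeasure E k).caratheodory :=
  (mkMetric'_isMetric _).borel_le_caratheodory

theorem inv_natCast_add_one_pos (j : ℕ) : (0 : ℝ≥0∞) < ((j : ℝ≥0∞) + 1)⁻¹ :=
  ENNReal.inv_pos.2 (by finiteness)

/-- Every set has a Borel hull of the same spherical measure. -/
theorem exists_borel_superset [MeasurableSpace E] [BorelSpace E] {k : ℕ} {A : Set E}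
    (hA : sphericalMeasure E k A ≠ ∞) :
    ∃ B, A ⊆ B ∧ MeasurableSet B ∧ sphericalMeasure E k B = sphericalMeasure E k A := by
  have h (j : ℕ) : ∃ B, A ⊆ B ∧ MeasurableSet B ∧
      mkMetric'.pre (ballGauge k) ((j : ℝ≥0∞) + 1)⁻¹ B
        ≤ sphericalMeasure E k A + ((j : ℝ≥0∞) + 1)⁻¹ := by
    obtain ⟨I, p, r, hAI, -, hd, hsum⟩ := exists_cover_of_pre_lt
      ((pre_le_sphericalMeasure k (inv_natCast_add_one_pos j) A).trans_lt
      (ENNReal.lt_add_right hA (inv_natCast_add_one_pos j).ne'))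
    exact ⟨_, hAI, MeasurableSet.iUnion fun i => isClosed_closedBall.measurableSet,
      (pre_le_tsum_of_cover k p r le_rfl hd).trans hsum.le⟩
  choose B hAB hB hle using h
  refine ⟨⋂ j, B j, subset_iInter hAB, MeasurableSet.iInter hB,
    le_antisymm ?_ (measure_mono (subset_iInter hAB))⟩
  refine ENNReal.le_of_forall_pos_le_add fun ε hε _ => sphericalMeasure_le_of_forall_pre_le
    fun j => ?_
  obtain ⟨l, hl⟩ := ENNReal.exists_inv_nat_lt (ENNReal.coe_pos.2 hε).ne'
  -- The index `max j l` serves both purposes: its scale is finer than `1/j`, and its error is below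
  -- `ε`.
  have h1 : ((max j l : ℕ) + 1 : ℝ≥0∞)⁻¹ ≤ (j : ℝ≥0∞)⁻¹ := by
    apply ENNReal.inv_le_inv.2
    exact_mod_cast (le_max_left j l).trans (Nat.le_succ _)
  have h2 : ((max j l : ℕ) + 1 : ℝ≥0∞)⁻¹ ≤ ε := by
    refine le_trans (ENNReal.inv_le_inv.2 ?_) hl.le
    exact_mod_cast (le_max_right j l).trans (Nat.le_succ _)
  calc mkMetric'.pre (ballGauge k) (j : ℝ≥0∞)⁻¹ (⋂ j, B j)
      ≤ mkMetric'.pre (ballGauge k) ((max j l : ℕ) + 1 : ℝ≥0∞)⁻¹ (⋂ j, B j) :=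
        mkMetric'.mono_pre _ h1 _
    _ ≤ mkMetric'.pre (ballGauge k) ((max j l : ℕ) + 1 : ℝ≥0∞)⁻¹ (B (max j l)) :=
        measure_mono (iInter_subset _ _)
    _ ≤ _ := hle _
    _ ≤ _ := by gcongr

theorem isCaratheodory_of_measurableSet [MeasurableSpace E] [BorelSpace E] {k : ℕ} {A : Set E}
    (hA : MeasurableSet A) : (sphericalMeasure E k).IsCaratheodory A := by
  rw [BorelSpace.measurable_eq (α := E)] at hA
  exact borel_le_caratheodory_sphericalMeasure k A hA

theorem isCaratheodory_of_null {α : Type*} {μ : OuterMeasure α} {N : Set α} (hN : μ N = 0) :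
    μ.IsCaratheodory N := by
  refine (isCaratheodory_iff_le' μ).2 fun t => ?_
  rw [measure_mono_null inter_subset_right hN, zero_add]
  exact measure_mono sdiff_subset

/-- A Carathéodory measurable set of finite spherical measure is exhausted by compact sets. -/
theorem exists_compact_exhaustion [MeasurableSpace E] [BorelSpace E] [CompleteSpace E]
    [SecondCountableTopology E] {k : ℕ} {X : Set E} (hX : (sphericalMeasure E k).IsCaratheodory X)
    (hfin : sphericalMeasure E k X ≠ ∞) :
    ∃ K : ℕ → Set E, Monotone K ∧ (∀ i, IsCompact (K i)) ∧ (∀ i, K i ⊆ X) ∧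
      sphericalMeasure E k (X \ ⋃ i, K i) = 0 := by
  set S := sphericalMeasure E k with hS
  -- With `B` a hull of `X` and `C` a hull of the null set `B \ X`, the Borel set `B \ C` lies in
  -- `X` and misses only a part of the null set `C`. The measure restricted to it is finite and
  -- Borel, hence inner regular for compact sets.
  obtain ⟨B, hXB, hB, hSB⟩ := exists_borel_superset hfin
  have hBX : S (B \ X) = 0 := by
    have := hX B
    rw [inter_eq_self_of_subset_right hXB, hSB] at this
    exact ((ENNReal.add_right_inj hfin).1 ((add_zero _).trans this)).symm
  obtain ⟨C, hBC, hC, hSC⟩ := exists_borel_superset (A := B \ X) (k := k)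
    (by rw [← hS, hBX]; exact ENNReal.zero_ne_top)
  rw [← hS, hBX] at hSC
  have hle : ‹MeasurableSpace E› ≤ S.caratheodory := by
    rw [BorelSpace.measurable_eq (α := E)]
    exact borel_le_caratheodory_sphericalMeasure k
  set ν := (S.toMeasure hle).restrict (B \ C) with hν
  have hν_apply : ∀ A, MeasurableSet A → ν A = S (A ∩ (B \ C)) := fun A hA => by
    rw [hν, Measure.restrict_apply hA, toMeasure_apply _ _ (hA.inter (hB.diff hC))]
  have hDX : B \ C ⊆ X := fun x hx => by
    by_contra h
    exact hx.2 (hBC ⟨hx.1, h⟩)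
  have : IsFiniteMeasure ν := ⟨by
    rw [hν_apply _ MeasurableSet.univ]
    exact (measure_mono (inter_subset_right.trans hDX)).trans_lt hfin.lt_top⟩
  have hK (j : ℕ) := (hB.diff hC).exists_isCompact_lt_add (μ := ν) (measure_ne_top _ _)
    (inv_natCast_add_one_pos j).ne'
  choose K hKD hKc hKlt using hK
  have hacc : ⋃ i, accumulate K i = ⋃ i, K i := iUnion_accumulate
  refine ⟨accumulate K, monotone_accumulate, fun i => ?_, fun i => ?_, ?_⟩
  · rw [accumulate_def]
    exact (finite_Iic i).isCompact_biUnion fun j _ => hKc j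
  · rw [accumulate_def]
    exact iUnion₂_subset fun j _ => (hKD j).trans hDX
  · rw [hacc]
    have h0 : S ((B \ C) \ ⋃ i, K i) = 0 := by
      have hm : MeasurableSet ((B \ C) \ ⋃ i, K i) :=
        (hB.diff hC).diff (MeasurableSet.iUnion fun i => (hKc i).measurableSet)
      have : S ((B \ C) \ ⋃ i, K i) = ν ((B \ C) \ ⋃ i, K i) := by
        rw [hν_apply _ hm, inter_eq_self_of_subset_left sdiff_subset]
      rw [this]
      refine le_antisymm (ENNReal.le_of_forall_pos_le_add fun ε hε _ => ?_) bot_le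
      obtain ⟨l, hl⟩ := ENNReal.exists_inv_nat_lt (ENNReal.coe_pos.2 hε).ne'
      calc ν ((B \ C) \ ⋃ i, K i) ≤ ν ((B \ C) \ K l) :=
            measure_mono (sdiff_subset_sdiff_right (subset_iUnion K l))
        _ = ν (B \ C) - ν (K l) :=
            measure_sdiff (hKD l) (hKc l).measurableSet.nullMeasurableSet (measure_ne_top _ _)
        _ ≤ ((l : ℝ≥0∞) + 1)⁻¹ := tsub_le_iff_left.2 (hKlt l).le
        _ ≤ (l : ℝ≥0∞)⁻¹ := ENNReal.inv_le_inv.2 le_self_add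
        _ ≤ 0 + ε := by rw [zero_add]; exact hl.le
    refine measure_mono_null (t := ((B \ C) \ ⋃ i, K i) ∪ C) (fun x hx => ?_)
      (measure_union_null h0 hSC)
    by_cases hxC : x ∈ C
    · exact Or.inr hxC
    · exact Or.inl ⟨⟨hXB hx.1, hxC⟩, hx.2⟩

end Covers

/-! ### Outer regularity and measurability in the level -/

section Normed

theorem ediam_closedBall_le_of_le {E : Type*} [PseudoMetricSpace E] {c : E} {r : ℝ≥0} {δ : ℝ≥0∞} (h : 2 * (r : ℝ≥0∞) ≤ δ) :
    ediam (closedBall c (r : ℝ)) ≤ δ := by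
  rw [← closedEBall_coe]
  exact ediam_closedEBall_le.trans h

variable {E : Type*} [NormedAddCommGroup E] [NormedSpace ℝ E]

/-- In a nontrivial real normed space the diameter of a closed ball is exactly twice its radius, so
bounds on diameters control radii. On a one-point space this fails. -/
theorem two_mul_radius_le_of_ediam_le [Nontrivial E] {c : E} {r : ℝ≥0} {δ : ℝ≥0∞}
    (h : ediam (closedBall c (r : ℝ)) ≤ δ) : 2 * (r : ℝ≥0∞) ≤ δ := by
  refine le_trans (le_of_eq ?_) h
  have h1 : ENNReal.ofReal (diam (closedBall c (r : ℝ))) = ediam (closedBall c (r : ℝ)) :=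
    ENNReal.ofReal_toReal isBounded_closedBall.ediam_ne_top
  rw [← h1, diam_closedBall_eq c r.coe_nonneg, ENNReal.ofReal_mul zero_le_two]
  simp

theorem exists_pos_radius_enlargement (k : ℕ) (r : ℝ≥0) {ε η : ℝ≥0} (hε : 0 < ε) (hη : 0 < η) :
    ∃ s : ℝ≥0, r < s ∧ s ≤ r + η ∧
      unitBallVolume k * (s : ℝ≥0∞) ^ k ≤ unitBallVolume k * (r : ℝ≥0∞) ^ k + ε := by
  have hc : Continuous fun s : ℝ≥0 => unitBallVolume k * (s : ℝ≥0∞) ^ k :=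
    ENNReal.continuous_const_mul (unitBallVolume_ne_top k) |>.comp
      ((ENNReal.continuous_pow k).comp ENNReal.continuous_coe)
  have hfin : unitBallVolume k * (r : ℝ≥0∞) ^ k ≠ ∞ :=
    ENNReal.mul_ne_top (unitBallVolume_ne_top k) (ENNReal.pow_ne_top ENNReal.coe_ne_top)
  have h1 : ∀ᶠ s : ℝ≥0 in 𝓝[>] r, unitBallVolume k * (s : ℝ≥0∞) ^ k
      < unitBallVolume k * (r : ℝ≥0∞) ^ k + ε :=
    (hc.tendsto r).mono_left nhdsWithin_le_nhds |>.eventually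
      (gt_mem_nhds (ENNReal.lt_add_right hfin (ENNReal.coe_pos.2 hε).ne'))
  have h2 : ∀ᶠ s : ℝ≥0 in 𝓝[>] r, s < r + η :=
    nhdsWithin_le_nhds (gt_mem_nhds (lt_add_of_pos_right r hη))
  obtain ⟨s, ⟨hs1, hs2⟩, hs3⟩ := ((h1.and h2).and self_mem_nhdsWithin).exists
  exact ⟨s, hs3, hs2.le, hs1.le⟩

/-- Outer regularity of the size `δ` approximations to the spherical measure. -/
theorem exists_isOpen_pre_lt [Nontrivial E] {k : ℕ} {A : Set E} {c δ : ℝ≥0∞} (hδ : 0 < δ)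
    (h : sphericalMeasure E k A < c) :
    ∃ O, IsOpen O ∧ A ⊆ O ∧ mkMetric'.pre (ballGauge k) δ O < c := by
  obtain ⟨η, hη0, hη⟩ := ENNReal.lt_iff_exists_nnreal_btwn.1 hδ
  have hη0' : 0 < η := ENNReal.coe_pos.1 hη0
  -- Diameters at most `η / 2` force radii at most `η / 4`, so enlarging each radius by at most `η /
  -- 4` keeps diameters below `η`.
  obtain ⟨I, p, r, hAI, -, hd, hsum⟩ := exists_cover_of_pre_lt
    ((pre_le_sphericalMeasure k (δ := (η / 2 : ℝ≥0)) (ENNReal.coe_pos.2 (half_pos hη0')) A).trans_lt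
      h)
  obtain ⟨e, he0, he⟩ := ENNReal.lt_iff_exists_add_pos_lt.1 hsum
  obtain ⟨ε, hε0, hε⟩ := ENNReal.exists_pos_sum_of_countable (ENNReal.coe_pos.2 he0).ne' I
  choose s hrs hsr hs using fun i =>
    exists_pos_radius_enlargement k (r i) (hε0 i) (show 0 < η / 4 by positivity)
  refine ⟨⋃ i, ball (p i) (s i), isOpen_iUnion fun i => isOpen_ball, hAI.trans
    (iUnion_mono fun i => closedBall_subset_ball (NNReal.coe_lt_coe.2 (hrs i))), ?_⟩
  calc mkMetric'.pre (ballGauge k) δ (⋃ i, ball (p i) (s i : ℝ))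
      ≤ ∑' i, unitBallVolume k * (s i : ℝ≥0∞) ^ k := by
        refine pre_le_tsum_of_cover k p s (iUnion_mono fun i => ball_subset_closedBall) fun i => ?_
        refine ediam_closedBall_le_of_le (le_trans ?_ hη.le)
        have h1 := two_mul_radius_le_of_ediam_le (hd i)
        have h2 : 2 * r i ≤ η / 2 := by exact_mod_cast h1
        have h3 : 2 * s i ≤ η := by
          have := hsr i
          rw [← NNReal.coe_le_coe] at *
          push_cast at *
          linarith
        exact_mod_cast h3
    _ ≤ ∑' i, (unitBallVolume k * (r i : ℝ≥0∞) ^ k + ε i) := ENNReal.tsum_le_tsum hs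
    _ = ∑' i, unitBallVolume k * (r i : ℝ≥0∞) ^ k + ∑' i, (ε i : ℝ≥0∞) := ENNReal.tsum_add
    _ ≤ ∑' i, unitBallVolume k * (r i : ℝ≥0∞) ^ k + e := by gcongr
    _ < c := he

/-- The spherical measure of the level sets of a continuous function on a compact set depends
measurably on the level. -/
theorem measurable_sphericalMeasure_levelSet [Nontrivial E] (k : ℕ) {K : Set E}
    (hK : IsCompact K) {u : E → ℝ} (hu : Continuous u) :
    Measurable fun t => sphericalMeasure E k {x ∈ K | u x = t} := by
  set φ : ℕ → ℝ → ℝ≥0∞ := fun j t => ⨅ (O : Set E) (_ : IsOpen O ∧ {x ∈ K | u x = t} ⊆ O),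
    mkMetric'.pre (ballGauge k) (j : ℝ≥0∞)⁻¹ O with hφ
  -- Upper semicontinuity: if an open `O` contains the slice at level `t`, then `t` avoids the
  -- compact set `u '' (K \ O)`, and so do nearby levels, whose slices therefore also lie in `O`.
  have hφm (j) : Measurable (φ j) := by
    refine measurable_of_Iio fun c => IsOpen.measurableSet ?_
    refine isOpen_iff_mem_nhds.2 fun t ht => ?_
    simp only [hφ, mem_preimage, mem_Iio, iInf_lt_iff] at ht
    obtain ⟨O, ⟨hO, hsub⟩, hlt⟩ := ht
    have hcl : IsClosed (u '' (K \ O)) := ((hK.diff hO).image hu).isClosed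
    have htn : t ∈ (u '' (K \ O))ᶜ := by
      rintro ⟨x, hx, hxt⟩
      exact hx.2 (hsub ⟨hx.1, hxt⟩)
    filter_upwards [hcl.isOpen_compl.mem_nhds htn] with s hs
    simp only [hφ, mem_preimage, mem_Iio, iInf_lt_iff]
    refine ⟨O, ⟨hO, fun x hx => ?_⟩, hlt⟩
    by_contra hxO
    exact hs ⟨x, ⟨hx.1, hxO⟩, hx.2⟩
  have heq : (fun t => sphericalMeasure E k {x ∈ K | u x = t}) = fun t => ⨆ j, φ j t := by
    funext t
    refine le_antisymm (sphericalMeasure_le_of_forall_pre_le fun j => ?_) (iSup_le fun j => ?_)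
    · refine le_iSup_of_le j (le_iInf₂ fun O hO => measure_mono hO.2)
    · refine le_of_forall_gt fun c hc => ?_
      obtain ⟨O, hO, hAO, hlt⟩ := exists_isOpen_pre_lt
        (δ := (j : ℝ≥0∞)⁻¹) (ENNReal.inv_pos.2 (ENNReal.natCast_ne_top j)) hc
      exact (iInf₂_le O ⟨hO, hAO⟩).trans_lt hlt
  rw [heq]
  exact Measurable.iSup hφm

end Normed

/-! ### Slices of a single ball and Cavalieri's principle -/

/-- A ball and the tube of radius `t` around an affine subspace meet in a set that is contained in
a ball of almost the same radius as that of the flat section of the ball at distance `t - d` from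
its centre, where `d` is the distance of the centre to the subspace. -/
theorem exists_dist_sq_le_of_infDist_eq {E : Type*} [NormedAddCommGroup E] [InnerProductSpace ℝ E]
    [FiniteDimensional ℝ E] (P : AffineSubspace ℝ E) (hP : (P : Set E).Nonempty) (p : E)
    (hd : 0 < infDist p P) {t : ℝ} (ht : 0 ≤ t) :
    ∃ q : E, ∀ x r, infDist x P = t → dist x p ≤ r →
      dist x q ^ 2 ≤ max 1 (t / infDist p P) * (r ^ 2 - (t - infDist p P) ^ 2) := by
  have : Nonempty P := hP.to_subtype
  set d := infDist p P with hd_def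
  let π : E → E := fun x => EuclideanGeometry.orthogonalProjection P x
  have hπ : ∀ x, ‖x - π x‖ = infDist x P := fun x => by
    rw [← EuclideanGeometry.dist_orthogonalProjection_eq_infDist P x, dist_eq_norm]
  -- The centre lies at distance `t` from `P` on the ray from `π p` through `p`. Both `‖x - p‖² - (t
  -- - d)²` and the squared distance to this centre are `‖a‖²` plus a multiple of the non-negative
  -- number `2 (t d - ⟪v, w⟫)`, with coefficients `1` and `t / d`.
  refine ⟨π p + (t / d) • (p - π p), fun x r hx hxr => ?_⟩
  obtain ⟨a, ha⟩ : ∃ a, a = π x - π p := ⟨_, rfl⟩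
  obtain ⟨v, hv⟩ : ∃ v, v = x - π x := ⟨_, rfl⟩
  obtain ⟨w, hw⟩ : ∃ w, w = p - π p := ⟨_, rfl⟩
  have had : a ∈ P.direction := by
    rw [ha]
    exact AffineSubspace.vsub_mem_direction (EuclideanGeometry.orthogonalProjection_mem x)
      (EuclideanGeometry.orthogonalProjection_mem p)
  have hvo : inner ℝ a v = 0 := by
    rw [hv]
    exact (Submodule.mem_orthogonal _ _).1
      (EuclideanGeometry.vsub_orthogonalProjection_mem_direction_orthogonal P x) a had
  have hwo : inner ℝ a w = 0 := by
    rw [hw]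
    exact (Submodule.mem_orthogonal _ _).1
      (EuclideanGeometry.vsub_orthogonalProjection_mem_direction_orthogonal P p) a had
  have hvn : ‖v‖ = t := by rw [hv, hπ, hx]
  have hwn : ‖w‖ = d := by rw [hw, hπ]
  have h1 : dist x p ^ 2 = ‖a‖ ^ 2 + (t ^ 2 - 2 * inner ℝ v w + d ^ 2) := by
    have : x - p = a + (v - w) := by rw [ha, hv, hw]; abel
    rw [dist_eq_norm, this, norm_add_sq_real, norm_sub_sq_real, inner_sub_right, hvo, hwo, hvn, hwn]
    ring
  have h2 : dist x (π p + (t / d) • (p - π p)) ^ 2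
      = ‖a‖ ^ 2 + (t ^ 2 - 2 * (t / d) * inner ℝ v w + t ^ 2) := by
    have : x - (π p + (t / d) • (p - π p)) = a + (v - (t / d) • w) := by rw [ha, hv, hw]; abel
    rw [dist_eq_norm, this, norm_add_sq_real, norm_sub_sq_real, inner_sub_right, inner_smul_right,
      inner_smul_right, hvo, hwo, norm_smul, hvn, hwn, Real.norm_of_nonneg (by positivity),
      div_mul_cancel₀ _ hd.ne']
    ring
  have h3 : inner ℝ v w ≤ t * d := by
    have := real_inner_le_norm v w
    rwa [hvn, hwn] at this
  have h4 : dist x p ^ 2 ≤ r ^ 2 := pow_le_pow_left₀ dist_nonneg hxr 2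
  have h5 : dist x (π p + (t / d) • (p - π p)) ^ 2
      = ‖a‖ ^ 2 + t / d * (2 * (t * d - inner ℝ v w)) := by
    rw [h2]
    field_simp
    ring
  rw [h5]
  have h6 : ‖a‖ ^ 2 + 2 * (t * d - inner ℝ v w) ≤ r ^ 2 - (t - d) ^ 2 := by
    rw [h1] at h4
    linarith
  calc ‖a‖ ^ 2 + t / d * (2 * (t * d - inner ℝ v w))
      ≤ max 1 (t / d) * ‖a‖ ^ 2 + max 1 (t / d) * (2 * (t * d - inner ℝ v w)) :=
        add_le_add (le_mul_of_one_le_left (sq_nonneg _) (le_max_left _ _))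
          (mul_le_mul_of_nonneg_right (le_max_right _ _) (by linarith))
    _ = max 1 (t / d) * (‖a‖ ^ 2 + 2 * (t * d - inner ℝ v w)) := by ring
    _ ≤ _ := by gcongr

theorem volume_closedBall_eq (k : ℕ) (r : ℝ≥0) :
    volume (closedBall (0 : EuclideanSpace ℝ (Fin k)) (r : ℝ))
      = unitBallVolume k * (r : ℝ≥0∞) ^ k := by
  rw [Measure.addHaar_closedBall' _ _ r.coe_nonneg, finrank_euclideanSpace_fin, mul_comm,
    ENNReal.ofReal_pow r.coe_nonneg, ENNReal.ofReal_coe_nnreal, unitBallVolume]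

theorem volume_sum_sq_le (k : ℕ) (r : ℝ≥0) :
    volume {z : Fin k → ℝ | ∑ i, z i ^ 2 ≤ (r : ℝ) ^ 2} = unitBallVolume k * (r : ℝ≥0∞) ^ k := by
  rw [← volume_closedBall_eq, ← (PiLp.volume_preserving_toLp (Fin k)).measure_preimage
    isClosed_closedBall.measurableSet.nullMeasurableSet]
  congr 1
  ext z
  simp only [mem_ofPred_eq, mem_preimage, mem_closedBall, dist_zero_right, EuclideanSpace.norm_eq,
    Real.norm_eq_abs, sq_abs]
  rw [Real.sqrt_le_left r.coe_nonneg]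

/-- The `k`-dimensional volume of the section of a `k + 1`-dimensional ball of radius `r` by a
hyperplane at signed distance `s` from its centre. -/
noncomputable def sectionVolume (k : ℕ) (r : ℝ≥0) (s : ℝ) : ℝ≥0∞ :=
  (Icc (-(r : ℝ)) r).indicator
    (fun s => unitBallVolume k * ENNReal.ofReal (√((r : ℝ) ^ 2 - s ^ 2)) ^ k) s

theorem measurable_sectionVolume (k : ℕ) (r : ℝ≥0) : Measurable (sectionVolume k r) := by
  unfold sectionVolume
  refine Measurable.indicator ?_ measurableSet_Icc
  fun_prop

/-- Fubini with the first coordinate split off: the section at height `s` is a ball of radius `√(r²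
- s²)`. -/
theorem lintegral_sectionVolume (k : ℕ) (r : ℝ≥0) :
    ∫⁻ s, sectionVolume k r s = unitBallVolume (k + 1) * (r : ℝ≥0∞) ^ (k + 1) := by
  have hm : MeasurableSet {z : Fin (k + 1) → ℝ | ∑ i, z i ^ 2 ≤ (r : ℝ) ^ 2} :=
    measurableSet_le (by fun_prop) measurable_const
  rw [← volume_sum_sq_le, ← (volume_preserving_piFinSuccAbove (fun _ => ℝ) 0).symm
    |>.measure_preimage hm.nullMeasurableSet, Measure.volume_eq_prod,
    Measure.prod_apply ((MeasurableEquiv.measurable _) hm)]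
  refine lintegral_congr fun s => ?_
  have : Prod.mk s ⁻¹' ((MeasurableEquiv.piFinSuccAbove (fun _ => ℝ) 0).symm ⁻¹'
      {z : Fin (k + 1) → ℝ | ∑ i, z i ^ 2 ≤ (r : ℝ) ^ 2})
      = {z : Fin k → ℝ | ∑ i, z i ^ 2 ≤ (r : ℝ) ^ 2 - s ^ 2} := by
    ext z
    simp [MeasurableEquiv.piFinSuccAbove, Fin.sum_univ_succ, le_sub_iff_add_le']
  rw [this]
  by_cases hs : s ∈ Icc (-(r : ℝ)) r
  · have h0 : 0 ≤ (r : ℝ) ^ 2 - s ^ 2 := by nlinarith [hs.1, hs.2]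
    have := volume_sum_sq_le k (√((r : ℝ) ^ 2 - s ^ 2)).toNNReal
    rw [Real.coe_toNNReal _ (Real.sqrt_nonneg _), Real.sq_sqrt h0] at this
    rw [this, sectionVolume, indicator_of_mem hs, ENNReal.ofReal]
  -- The cut-off matters for `k = 0`: the section is empty, while the formula would give `0 ^ 0 =
  -- 1`.
  · rw [sectionVolume, indicator_of_notMem hs]
    symm
    convert measure_empty (μ := (volume : Measure (Fin k → ℝ)))
    refine eq_empty_of_forall_notMem fun z hz => hs ?_
    have h1 : 0 ≤ ∑ i, z i ^ 2 := Finset.sum_nonneg fun i _ => sq_nonneg _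
    have h2 : s ^ 2 ≤ (r : ℝ) ^ 2 := by
      have := h1.trans hz
      linarith
    exact abs_le.1 (abs_le_of_sq_le_sq h2 r.coe_nonneg)

/-! ### Measure and measurability of slices of sets -/

section SliceBound

variable {E : Type*} [NormedAddCommGroup E] [InnerProductSpace ℝ E] [FiniteDimensional ℝ E]
  (P : AffineSubspace ℝ E)

/-- A nonempty slice has `|t - d| ≤ r`, since the distance to `P` is 1-Lipschitz. Then `t ≤ d + r ≤
a d`, so `a` dominates the distortion factor `max 1 (t / d)`. -/
theorem pre_slice_closedBall_le (hP : (P : Set E).Nonempty) (k : ℕ) {p : E} (hd : 0 < infDist p P) {t : ℝ}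
    (ht : 0 ≤ t) {r a : ℝ≥0} (ha : 1 ≤ a) (hra : infDist p P + r ≤ a * infDist p P) {δ : ℝ≥0∞}
    (hδ : 2 * ((a * r : ℝ≥0) : ℝ≥0∞) ≤ δ) :
    mkMetric'.pre (ballGauge k) δ (slice (closedBall p (r : ℝ)) P t)
      ≤ (a : ℝ≥0∞) ^ k * sectionVolume k r (t - infDist p P) := by
  set d := infDist p P with hd_def
  by_cases hs : t - d ∈ Icc (-(r : ℝ)) r
  · obtain ⟨q, hq⟩ := exists_dist_sq_le_of_infDist_eq P hP p hd ht
    have h0 : 0 ≤ (r : ℝ) ^ 2 - (t - d) ^ 2 := by nlinarith [hs.1, hs.2]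
    set c : ℝ≥0 := (√((r : ℝ) ^ 2 - (t - d) ^ 2)).toNNReal with hc
    have hcc : (c : ℝ) = √((r : ℝ) ^ 2 - (t - d) ^ 2) := Real.coe_toNNReal _ (Real.sqrt_nonneg _)
    have hcr : c ≤ r := by
      rw [← NNReal.coe_le_coe, hcc, Real.sqrt_le_left r.coe_nonneg]
      linarith [sq_nonneg (t - d)]
    have hta : max 1 (t / d) ≤ (a : ℝ) := by
      refine max_le (by exact_mod_cast ha) ((div_le_iff₀ hd).2 ?_)
      linarith [hs.2]
    have hsub : slice (closedBall p (r : ℝ)) P t ⊆ closedBall q ((a * c : ℝ≥0) : ℝ) := by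
      rintro x ⟨hx, hxt⟩
      rw [mem_closedBall]
      refine abs_le_of_sq_le_sq' (a := dist x q) ?_ (NNReal.coe_nonneg _) |>.2
      calc dist x q ^ 2 ≤ max 1 (t / d) * ((r : ℝ) ^ 2 - (t - d) ^ 2) := hq x r hxt hx
        _ ≤ a * ((r : ℝ) ^ 2 - (t - d) ^ 2) := by gcongr
        _ ≤ (a : ℝ) ^ 2 * ((r : ℝ) ^ 2 - (t - d) ^ 2) := by
            have : (a : ℝ) ≤ (a : ℝ) ^ 2 := le_self_pow₀ (by exact_mod_cast ha) two_ne_zero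
            gcongr
        _ = ((a * c : ℝ≥0) : ℝ) ^ 2 := by
            rw [NNReal.coe_mul, mul_pow, hcc, Real.sq_sqrt h0]
    calc mkMetric'.pre (ballGauge k) δ (slice (closedBall p (r : ℝ)) P t)
        ≤ mkMetric'.pre (ballGauge k) δ (closedBall q ((a * c : ℝ≥0) : ℝ)) := measure_mono hsub
      _ ≤ ballGauge k (closedBall q ((a * c : ℝ≥0) : ℝ)) := by
          refine mkMetric'.pre_le (ediam_closedBall_le_of_le (le_trans ?_ hδ))
          gcongr
      _ ≤ unitBallVolume k * ((a * c : ℝ≥0) : ℝ≥0∞) ^ k := ballGauge_closedBall_le k _ _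
      _ = (a : ℝ≥0∞) ^ k * sectionVolume k r (t - d) := by
          rw [sectionVolume, indicator_of_mem hs, ENNReal.coe_mul, mul_pow, hc, ENNReal.ofReal]
          ring
  · have : slice (closedBall p (r : ℝ)) P t = ∅ := by
      refine eq_empty_of_forall_notMem fun x hx => hs ?_
      have h1 : dist x p ≤ r := hx.1
      have h2 : infDist x P = t := hx.2
      have h3 : infDist x P ≤ infDist p P + dist x p := infDist_le_infDist_add_dist
      have h4 : infDist p P ≤ infDist x P + dist p x := infDist_le_infDist_add_dist
      rw [dist_comm p x] at h4
      constructor <;> linarith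
    rw [this, measure_empty]
    exact zero_le

/-- The upper integral over the slices away from the subspace is bounded by the measure of the
sliced set. -/
theorem exists_measurable_slice_bound [Nontrivial E] (hP : (P : Set E).Nonempty)
    (k : ℕ) (A : Set E) {ε : ℝ} (hε : 0 < ε) :
    ∃ g : ℝ → ℝ≥0∞, Measurable g ∧ (∀ t, ε < t → sphericalMeasure E k (slice A P t) ≤ g t) ∧
      ∫⁻ t in Ioi ε, g t ≤ sphericalMeasure E (k + 1) A := by
  by_cases hA : sphericalMeasure E (k + 1) A = ∞
  · exact ⟨fun _ => ∞, measurable_const, fun _ _ => le_top, by rw [hA]; exact le_top⟩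
  set S := sphericalMeasure E (k + 1) A with hS
  -- Balls of radius at most `ε b j / 4` meeting `A'` have centres at distance `d ≥ ε / 2` from `P`,
  -- so `1 + r / d ≤ 1 + b j`, which tends to 1.
  set A' := A ∩ {x | ε < infDist x P} with hA'
  set b : ℕ → ℝ≥0 := fun j => ((j : ℝ≥0) + 1)⁻¹ with hb
  have hb0 : ∀ j, 0 < b j := fun j => by positivity
  have hb1 : ∀ j, b j ≤ 1 := fun j => inv_le_one_of_one_le₀ (by simp)
  have hblim : Tendsto b atTop (𝓝 0) := by
    have := tendsto_inv_atTop_zero.comp (tendsto_natCast_atTop_atTop (R := ℝ≥0))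
    exact (tendsto_add_atTop_iff_nat 1).2 this |>.congr fun j => by simp [hb]
  set e : ℝ≥0 := ε.toNNReal with he
  have hee : (e : ℝ) = ε := Real.coe_toNNReal _ hε.le
  have he0 : 0 < e := Real.toNNReal_pos.2 hε
  have hcov (j : ℕ) := exists_cover_of_pre_lt (k := k + 1) (δ := (e / 2 * b j : ℝ≥0)) (A := A')
    (c := S + b j) <| (pre_le_sphericalMeasure (k + 1)
      (ENNReal.coe_pos.2 (mul_pos (half_pos he0) (hb0 j))) A').trans_lt <|
      (measure_mono inter_subset_left).trans_lt
        (ENNReal.lt_add_right hA (ENNReal.coe_pos.2 (hb0 j)).ne')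
  choose I p r hcover hmeet hdiam hsum using hcov
  have hr : ∀ j i, 2 * r j i ≤ e / 2 * b j := fun j i => by
    exact_mod_cast two_mul_radius_le_of_ediam_le (hdiam j i)
  have hr' : ∀ j i, 2 * (r j i : ℝ) ≤ ε / 2 * b j := fun j i => by
    have := NNReal.coe_le_coe.2 (hr j i)
    push_cast at this
    rwa [hee] at this
  have hd : ∀ j i, ε / 2 ≤ infDist (p j i) P := fun j i => by
    obtain ⟨x, hx, -, hxε⟩ := hmeet j i
    have h1 : dist x (p j i) ≤ r j i := hx
    have h2 : ε < infDist x P := hxε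
    have h3 : infDist x P ≤ infDist (p j i) P + dist x (p j i) := infDist_le_infDist_add_dist
    have h4 : (b j : ℝ) ≤ 1 := by exact_mod_cast hb1 j
    nlinarith [hr' j i]
  set g : ℕ → ℝ → ℝ≥0∞ := fun j t =>
    ∑' i, ((1 + b j : ℝ≥0) : ℝ≥0∞) ^ k * sectionVolume k (r j i) (t - infDist (p j i) P) with hg
  have hterm (j) (i : I j) : Measurable fun t => sectionVolume k (r j i) (t - infDist (p j i) P) :=
    (measurable_sectionVolume k _).comp (measurable_id.sub_const _)
  have hgm (j) : Measurable (g j) := Measurable.tsum fun i => (hterm j i).const_mul _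
  have hpre (j : ℕ) {t : ℝ} (ht : ε < t) :
      mkMetric'.pre (ballGauge k) (2 * (e * b j : ℝ≥0)) (slice A P t) ≤ g j t := by
    have hsub : slice A P t ⊆ ⋃ i, slice (closedBall (p j i) (r j i : ℝ)) P t := fun x hx => by
      have hxA : x ∈ A' := ⟨hx.1, by
        have : infDist x P = t := hx.2
        rwa [mem_ofPred_eq, this]⟩
      obtain ⟨i, hi⟩ := mem_iUnion.1 (hcover j hxA)
      exact mem_iUnion.2 ⟨i, hi, hx.2⟩
    refine (measure_mono hsub).trans <| (measure_iUnion_le _).trans <|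
      ENNReal.tsum_le_tsum fun i => ?_
    refine pre_slice_closedBall_le P hP k (lt_of_lt_of_le (half_pos hε) (hd j i))
      (hε.trans ht).le le_self_add ?_ ?_
    · have h1 := hd j i
      have h2 := hr' j i
      have h3 : (0 : ℝ) ≤ b j := (b j).coe_nonneg
      push_cast
      nlinarith
    · have h1 : (1 + b j) * r j i ≤ e * b j := by
        have h2 := hr' j i
        have h3 : (b j : ℝ) ≤ 1 := by exact_mod_cast hb1 j
        rw [← NNReal.coe_le_coe]
        push_cast
        rw [hee]
        nlinarith [(r j i).coe_nonneg]
      gcongr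
  refine ⟨fun t => liminf (fun j => g j t) atTop, Measurable.liminf hgm, fun t ht => ?_, ?_⟩
  · refine sphericalMeasure_le_of_forall_pre_le fun l => le_liminf_of_le (by isBoundedDefault) ?_
    have hlim : Tendsto (fun j => (2 * (e * b j : ℝ≥0) : ℝ≥0∞)) atTop (𝓝 0) := by
      have : Tendsto (fun j => 2 * (e * b j)) atTop (𝓝 (2 * (e * 0))) :=
        (hblim.const_mul e).const_mul 2
      rw [mul_zero, mul_zero] at this
      simpa using ENNReal.tendsto_coe.2 this
    filter_upwards [hlim.eventually (gt_mem_nhds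
      (ENNReal.inv_pos.2 (ENNReal.natCast_ne_top l)))] with j hj
    exact (mkMetric'.mono_pre _ hj.le _).trans (hpre j ht)
  · have hint (j : ℕ) : ∫⁻ t in Ioi ε, g j t ≤ ((1 + b j : ℝ≥0) : ℝ≥0∞) ^ k * (S + b j) := by
      calc ∫⁻ t in Ioi ε, g j t ≤ ∫⁻ t, g j t := setLIntegral_le_lintegral _ _
        _ = ∑' i, ∫⁻ t, ((1 + b j : ℝ≥0) : ℝ≥0∞) ^ k *
              sectionVolume k (r j i) (t - infDist (p j i) P) :=
            lintegral_tsum fun i => ((hterm j i).const_mul _).aemeasurable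
        _ = ∑' i, ((1 + b j : ℝ≥0) : ℝ≥0∞) ^ k *
              (unitBallVolume (k + 1) * (r j i : ℝ≥0∞) ^ (k + 1)) := by
            refine tsum_congr fun i => ?_
            rw [lintegral_const_mul _ (hterm j i),
              lintegral_sub_right_eq_self (sectionVolume k (r j i)), lintegral_sectionVolume]
        _ = ((1 + b j : ℝ≥0) : ℝ≥0∞) ^ k *
              ∑' i, unitBallVolume (k + 1) * (r j i : ℝ≥0∞) ^ (k + 1) := ENNReal.tsum_mul_left
        _ ≤ _ := by gcongr; exact (hsum j).le
    have hlim : Tendsto (fun j => ((1 + b j : ℝ≥0) : ℝ≥0∞) ^ k * (S + b j)) atTop (𝓝 S) := by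
      have h1 : Tendsto (fun j => ((1 + b j : ℝ≥0) : ℝ≥0∞) ^ k) atTop (𝓝 1) := by
        have : Tendsto (fun j => (1 + b j) ^ k) atTop (𝓝 ((1 + 0) ^ k)) :=
          (hblim.const_add 1).pow k
        rw [add_zero, one_pow] at this
        simpa using ENNReal.tendsto_coe.2 this
      have h2 : Tendsto (fun j => S + (b j : ℝ≥0∞)) atTop (𝓝 (S + 0)) :=
        tendsto_const_nhds.add (by simpa using ENNReal.tendsto_coe.2 hblim)
      rw [add_zero] at h2
      simpa using ENNReal.Tendsto.mul h1 (Or.inl one_ne_zero) h2 (Or.inr ENNReal.one_ne_top)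
    calc ∫⁻ t in Ioi ε, liminf (fun j => g j t) atTop
        ≤ liminf (fun j => ∫⁻ t in Ioi ε, g j t) atTop := lintegral_liminf_le hgm
      _ ≤ liminf (fun j => ((1 + b j : ℝ≥0) : ℝ≥0∞) ^ k * (S + b j)) atTop :=
          liminf_le_liminf (Eventually.of_forall hint)
      _ = S := hlim.liminf_eq

theorem iUnion_Ioi_one_div_add_one : ⋃ l : ℕ, Ioi (1 / ((l : ℝ) + 1)) = Ioi 0 := by
  ext t
  simp only [mem_iUnion, mem_Ioi]
  exact ⟨fun ⟨l, hl⟩ => lt_trans (by positivity) hl, exists_nat_one_div_lt⟩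

theorem lintegral_slice_le [Nontrivial E] (hP : (P : Set E).Nonempty)
    (k : ℕ) (A : Set E) :
    ∫⁻ t in Ioi (0 : ℝ), sphericalMeasure E k (slice A P t) ≤ sphericalMeasure E (k + 1) A := by
  rw [← iUnion_Ioi_one_div_add_one, setLIntegral_iUnion_of_directed]
  · refine iSup_le fun l => ?_
    obtain ⟨g, -, hg, hint⟩ := exists_measurable_slice_bound P hP k A
      (ε := 1 / ((l : ℝ) + 1)) (by positivity)
    exact (setLIntegral_mono' measurableSet_Ioi hg).trans hint
  · exact directed_of_isDirected_le fun i j hij => Ioi_subset_Ioi (by gcongr)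

/-- The measurable majorant is essential: for a possibly non-measurable integrand, a vanishing `∫⁻`
alone would not give vanishing almost everywhere. -/
theorem ae_slice_null [Nontrivial E] (hP : (P : Set E).Nonempty)
    (k : ℕ) {N : Set E} (hN : sphericalMeasure E (k + 1) N = 0) :
    ∀ᵐ t ∂(volume.restrict (Ioi (0 : ℝ))), sphericalMeasure E k (slice N P t) = 0 := by
  rw [← iUnion_Ioi_one_div_add_one, ae_restrict_iUnion_iff]
  intro l
  obtain ⟨g, hgm, hg, hint⟩ := exists_measurable_slice_bound P hP k N
    (ε := 1 / ((l : ℝ) + 1)) (by positivity)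
  rw [hN] at hint
  filter_upwards [(lintegral_eq_zero_iff hgm).1 (le_antisymm hint zero_le),
    ae_restrict_mem measurableSet_Ioi] with t ht htl
  exact le_antisymm ((hg t htl).trans ht.le) zero_le

theorem isClosed_setOf_infDist_eq {F : Type*} [PseudoMetricSpace F] (Q : Set F) (t : ℝ) :
    IsClosed {x | infDist x Q = t} :=
  isClosed_eq (continuous_infDist_pt Q) continuous_const

/-- Slices of Carathéodory measurable sets of finite measure are almost all measurable, and their
measure depends measurably on the distance. -/
theorem ae_isCaratheodory_slice [Nontrivial E] (hP : (P : Set E).Nonempty)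
    (k : ℕ) {X : Set E}
    (hX : (sphericalMeasure E (k + 1)).IsCaratheodory X)
    (hfin : sphericalMeasure E (k + 1) X ≠ ∞) :
    (∀ᵐ t ∂(volume.restrict (Ioi (0 : ℝ))),
      (sphericalMeasure E k).IsCaratheodory (slice X P t)) ∧
    AEMeasurable (fun t => sphericalMeasure E k (slice X P t))
      (volume.restrict (Ioi (0 : ℝ))) := by
  borelize E
  have : CompleteSpace E := FiniteDimensional.complete ℝ E
  have : ProperSpace E := FiniteDimensional.proper ℝ E
  obtain ⟨K, hKm, hKc, hKX, hN⟩ := exists_compact_exhaustion hX hfin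
  -- For almost every `t`, the slice of `X` is a Borel union of compact slices plus a null set;
  -- continuity from below then gives its measure as a supremum.
  have hnull := ae_slice_null P hP k hN
  have hdec (t : ℝ) : slice X P t = (⋃ i, slice (K i) P t) ∪ slice (X \ ⋃ i, K i) P t := by
    ext x
    simp only [slice, mem_union, mem_iUnion, mem_ofPred_eq, Set.mem_sdiff]
    constructor
    · rintro ⟨hx, hxt⟩
      by_cases h : x ∈ ⋃ i, K i
      · exact Or.inl ((mem_iUnion.1 h).imp fun i hi => ⟨hi, hxt⟩)
      · exact Or.inr ⟨⟨hx, fun h' => h (mem_iUnion.2 h')⟩, hxt⟩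
    · rintro (⟨i, hi, hxt⟩ | ⟨⟨hx, -⟩, hxt⟩)
      exacts [⟨hKX i hi, hxt⟩, ⟨hx, hxt⟩]
  have hKt (i : ℕ) (t : ℝ) : MeasurableSet (slice (K i) P t) :=
    (hKc i).measurableSet.inter (isClosed_setOf_infDist_eq _ t).measurableSet
  have hU (t : ℝ) : MeasurableSet (⋃ i, slice (K i) P t) := MeasurableSet.iUnion fun i => hKt i t
  refine ⟨?_, ?_⟩
  · filter_upwards [hnull] with t ht
    rw [hdec t]
    exact isCaratheodory_union _ (isCaratheodory_of_measurableSet (hU t))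
      (isCaratheodory_of_null ht)
  · have hm : Measurable fun t => ⨆ i, sphericalMeasure E k (slice (K i) P t) :=
      Measurable.iSup fun i =>
        measurable_sphericalMeasure_levelSet k (hKc i) (continuous_infDist_pt _)
    refine hm.aemeasurable.congr ?_
    filter_upwards [hnull] with t ht
    have hle : ‹MeasurableSpace E› ≤ (sphericalMeasure E k).caratheodory := by
      rw [BorelSpace.measurable_eq (α := E)]
      exact borel_le_caratheodory_sphericalMeasure k
    have h1 : sphericalMeasure E k (⋃ i, slice (K i) P t)
        = ⨆ i, sphericalMeasure E k (slice (K i) P t) := by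
      have hmono : Monotone fun i => slice (K i) P t := fun i j hij x hx => ⟨hKm hij hx.1, hx.2⟩
      have := hmono.measure_iUnion (μ := (sphericalMeasure E k).toMeasure hle)
      rw [toMeasure_apply _ _ (hU t)] at this
      rw [this]
      exact iSup_congr fun i => toMeasure_apply _ _ (hKt i t)
    rw [← h1, hdec t]
    exact le_antisymm (measure_mono subset_union_left)
      ((measure_union_le _ _).trans (by rw [ht, add_zero]))

end SliceBound

/-! ### Integration over the Carathéodory σ-algebra -/

section CaratheodoryIntegral

variable {α : Type*} (μ : OuterMeasure α)

/-- The integral of an extended non-negative function with respect to the measure that an outer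
measure induces on its Carathéodory measurable sets. -/
noncomputable def caratheodoryIntegral (F : α → ℝ≥0∞) : ℝ≥0∞ :=
  letI : MeasurableSpace α := μ.caratheodory
  ∫⁻ q, F q ∂(μ.toMeasure le_rfl)

/-- The outer measure is an explicit argument because two Carathéodory σ-algebras, of dimensions `k`
and `k + 1`, are used on the same space below. -/
theorem caratheodoryIntegral_indicator_const {s : Set α} (hs : μ.IsCaratheodory s) (c : ℝ≥0∞) :
    caratheodoryIntegral μ (s.indicator fun _ => c) = c * μ s := by
  let _ : MeasurableSpace α := μ.caratheodory
  have hs' : MeasurableSet s := hs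
  rw [caratheodoryIntegral, lintegral_indicator_const hs', toMeasure_apply _ _ hs']

theorem caratheodoryIntegral_add {F G : α → ℝ≥0∞} (hF : Measurable[μ.caratheodory] F) :
    caratheodoryIntegral μ (F + G) = caratheodoryIntegral μ F + caratheodoryIntegral μ G := by
  let _ : MeasurableSpace α := μ.caratheodory
  exact lintegral_add_left hF G

theorem caratheodoryIntegral_iSup {F : ℕ → α → ℝ≥0∞} (hF : ∀ n, Measurable[μ.caratheodory] (F n))
    (hmono : Monotone F) :
    caratheodoryIntegral μ (fun x => ⨆ n, F n x) = ⨆ n, caratheodoryIntegral μ (F n) := by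
  let _ : MeasurableSpace α := μ.caratheodory
  exact lintegral_iSup hF hmono

theorem caratheodoryIntegral_mono {F G : α → ℝ≥0∞} (h : F ≤ G) :
    caratheodoryIntegral μ F ≤ caratheodoryIntegral μ G := by
  let _ : MeasurableSpace α := μ.caratheodory
  exact lintegral_mono h

theorem integralOn_eq_caratheodoryIntegral {X : Set α} (hX : μ.IsCaratheodory X) (f : α → ℝ) :
    integralOn μ X f = caratheodoryIntegral μ (X.indicator fun q => ENNReal.ofReal (f q)) := by
  let _ : MeasurableSpace α := μ.caratheodory
  have hX' : MeasurableSet X := hX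
  rw [integralOn, caratheodoryIntegral, lintegral_indicator hX']

end CaratheodoryIntegral

/-! ### Slicing of functions -/

section SliceIntegral

variable {E : Type*} [NormedAddCommGroup E] [InnerProductSpace ℝ E] [FiniteDimensional ℝ E]

theorem indicator_slice_indicator {F : Type*} [PseudoMetricSpace F] (X s Q : Set F) (t : ℝ)
    (G : F → ℝ≥0∞) :
    (slice X Q t).indicator (s.indicator G) = (slice (X ∩ s) Q t).indicator G := by
  rw [indicator_indicator]
  congr 1
  ext x
  simp only [slice, mem_inter_iff, mem_ofPred_eq]
  tauto

/-- The slicing inequality for extended non-negative measurable functions. -/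
theorem slicing_ennreal [Nontrivial E] (P : AffineSubspace ℝ E) (hP : (P : Set E).Nonempty)
    (k : ℕ) {X : Set E} (hX : (sphericalMeasure E (k + 1)).IsCaratheodory X)
    (hfin : sphericalMeasure E (k + 1) X ≠ ∞) {F : E → ℝ≥0∞}
    (hF : Measurable[(sphericalMeasure E (k + 1)).caratheodory] F) :
    (∀ᵐ t ∂(volume.restrict (Ioi (0 : ℝ))),
      Measurable[(sphericalMeasure E k).caratheodory] ((slice X P t).indicator F)) ∧
    AEMeasurable
      (fun t => caratheodoryIntegral (sphericalMeasure E k) ((slice X P t).indicator F))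
      (volume.restrict (Ioi (0 : ℝ))) ∧
    ∫⁻ t in Ioi (0 : ℝ), caratheodoryIntegral (sphericalMeasure E k) ((slice X P t).indicator F)
      ≤ caratheodoryIntegral (sphericalMeasure E (k + 1)) (X.indicator F) := by
  -- The three claims go through the induction together: additivity and monotone convergence on the
  -- slices require their almost everywhere measurability.
  refine @Measurable.ennreal_induction E (sphericalMeasure E (k + 1)).caratheodory (fun F =>
    (∀ᵐ t ∂(volume.restrict (Ioi (0 : ℝ))),
      Measurable[(sphericalMeasure E k).caratheodory] ((slice X P t).indicator F)) ∧
    AEMeasurable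
      (fun t => caratheodoryIntegral (sphericalMeasure E k) ((slice X P t).indicator F))
      (volume.restrict (Ioi (0 : ℝ))) ∧
    ∫⁻ t in Ioi (0 : ℝ), caratheodoryIntegral (sphericalMeasure E k) ((slice X P t).indicator F)
      ≤ caratheodoryIntegral (sphericalMeasure E (k + 1)) (X.indicator F)) ?_ ?_ ?_ F hF
  · intro c s hs
    have hXs : (sphericalMeasure E (k + 1)).IsCaratheodory (X ∩ s) := isCaratheodory_inter _ hX hs
    obtain ⟨h1, h2⟩ := ae_isCaratheodory_slice P hP k hXs
      (ne_top_of_le_ne_top hfin (measure_mono inter_subset_left))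
    simp only [indicator_slice_indicator]
    have h3 : (fun t => caratheodoryIntegral (sphericalMeasure E k)
        ((slice (X ∩ s) P t).indicator fun _ => c)) =ᵐ[volume.restrict (Ioi (0 : ℝ))]
        fun t => c * sphericalMeasure E k (slice (X ∩ s) P t) := by
      filter_upwards [h1] with t ht
      exact caratheodoryIntegral_indicator_const _ ht c
    refine ⟨?_, (h2.const_mul c).congr h3.symm, ?_⟩
    · filter_upwards [h1] with t ht
      exact Measurable.indicator (@measurable_const _ _ _ (sphericalMeasure E k).caratheodory c) ht
    · rw [lintegral_congr_ae h3, lintegral_const_mul'' _ h2, indicator_indicator,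
        caratheodoryIntegral_indicator_const _ hXs]
      gcongr
      exact lintegral_slice_le P hP k _
  · rintro F G - hFm hGm ⟨hF1, hF2, hF3⟩ ⟨hG1, hG2, hG3⟩
    have h3 : (fun t => caratheodoryIntegral (sphericalMeasure E k)
        ((slice X P t).indicator (F + G))) =ᵐ[volume.restrict (Ioi (0 : ℝ))]
        fun t => caratheodoryIntegral (sphericalMeasure E k) ((slice X P t).indicator F) +
          caratheodoryIntegral (sphericalMeasure E k) ((slice X P t).indicator G) := by
      filter_upwards [hF1] with t ht
      rw [indicator_add']
      exact caratheodoryIntegral_add _ ht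
    refine ⟨?_, (hF2.add hG2).congr h3.symm, ?_⟩
    · filter_upwards [hF1, hG1] with t ht ht'
      rw [indicator_add']
      exact Measurable.add ht ht'
    · rw [lintegral_congr_ae h3, lintegral_add_left' hF2, indicator_add',
        caratheodoryIntegral_add _ (Measurable.indicator hFm hX)]
      exact add_le_add hF3 hG3
  · intro F hFm hmono hF
    have hind (A : Set E) : A.indicator (fun x => ⨆ n, F n x)
        = fun x => ⨆ n, A.indicator (F n) x := by
      ext x
      by_cases hx : x ∈ A <;> simp [hx]
    have hindm (A : Set E) : Monotone fun n => A.indicator (F n) := fun i j hij x =>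
      indicator_le_indicator (hmono hij x)
    have h1 := ae_all_iff.2 fun n => (hF n).1
    simp only [hind]
    have h3 : (fun t => caratheodoryIntegral (sphericalMeasure E k)
        (fun x => ⨆ n, (slice X P t).indicator (F n) x)) =ᵐ[volume.restrict (Ioi (0 : ℝ))]
        fun t => ⨆ n, caratheodoryIntegral (sphericalMeasure E k)
          ((slice X P t).indicator (F n)) := by
      filter_upwards [h1] with t ht
      exact caratheodoryIntegral_iSup _ ht (hindm _)
    refine ⟨?_, (AEMeasurable.iSup fun n => (hF n).2.1).congr h3.symm, ?_⟩
    · filter_upwards [h1] with t ht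
      exact Measurable.iSup ht
    · rw [lintegral_congr_ae h3, lintegral_iSup' (fun n => (hF n).2.1)
        (Eventually.of_forall fun t i j hij => caratheodoryIntegral_mono _ (hindm _ hij)),
        caratheodoryIntegral_iSup _ (fun n => Measurable.indicator (hFm n) hX) (hindm X)]
      exact iSup_mono fun n => (hF n).2.2

end SliceIntegral

/-- On `X`, non-negativity lets `f` be recovered from its truncation by `ENNReal.toReal`; off `X`
the indicator is constant. -/
theorem isMeasurableOn_iff_of_nonneg {α : Type*} {μ : OuterMeasure α} {X : Set α} {f : α → ℝ}
    (hf : ∀ x ∈ X, 0 ≤ f x) (hX : μ.IsCaratheodory X) :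
    IsMeasurableOn μ X f ↔
      Measurable[μ.caratheodory] (X.indicator fun q => ENNReal.ofReal (f q)) := by
  let _ : MeasurableSpace α := μ.caratheodory
  have hX' : MeasurableSet X := hX
  refine ⟨fun h => ?_, fun h => ⟨hX, fun U hU => ?_⟩⟩
  · refine measurable_of_restrict_of_restrict_compl hX' ?_ ?_
    · have : X.domRestrict (X.indicator fun q => ENNReal.ofReal (f q))
          = fun q => ENNReal.ofReal (X.domRestrict f q) := by
        ext q
        simp [domRestrict_apply]
      rw [this]
      refine ENNReal.measurable_ofReal.comp (f := X.domRestrict f) fun U hU => ?_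
      refine ⟨X ∩ f ⁻¹' U, h.2 U hU, ?_⟩
      ext ⟨x, hx⟩
      simp
    · have : Xᶜ.domRestrict (X.indicator fun q => ENNReal.ofReal (f q)) = fun _ => 0 := by
        ext ⟨q, hq⟩
        exact indicator_of_notMem hq _
      rw [this]
      exact measurable_const
  · have : X ∩ f ⁻¹' U
        = X ∩ (fun q => (X.indicator (fun q => ENNReal.ofReal (f q)) q).toReal) ⁻¹' U := by
      ext x
      refine and_congr_right fun hx => ?_
      rw [mem_preimage, mem_preimage, indicator_of_mem hx, ENNReal.toReal_ofReal (hf x hx)]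
    rw [this]
    exact hX'.inter (h.ennreal_toReal hU)

end Slicing

theorem mainTheorem11 (n m M : ℕ) (hm : 1 ≤ m) (hM : M < n)
    (P : AffineSubspace ℝ (EuclideanSpace ℝ (Fin n)))
    (hP : (P : Set (EuclideanSpace ℝ (Fin n))).Nonempty)
    (hPM : Module.finrank ℝ P.direction = M)
    (X : Set (EuclideanSpace ℝ (Fin n)))
    (hX : Slicing.sphericalMeasure (EuclideanSpace ℝ (Fin n)) m X < ∞)
    (f : EuclideanSpace ℝ (Fin n) → ℝ)
    (hf : Slicing.IsMeasurableOn (Slicing.sphericalMeasure (EuclideanSpace ℝ (Fin n)) m) X f)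
    (hf0 : ∀ x ∈ X, 0 ≤ f x) (hfb : ∃ K : ℝ, ∀ x ∈ X, f x ≤ K) :
    (∀ᵐ t ∂(volume.restrict (Ioi (0 : ℝ))),
      Slicing.IsMeasurableOn (Slicing.sphericalMeasure (EuclideanSpace ℝ (Fin n)) (m - 1))
        (Slicing.slice X P t) f) ∧
    AEMeasurable (fun t : ℝ =>
      Slicing.integralOn (Slicing.sphericalMeasure (EuclideanSpace ℝ (Fin n)) (m - 1))
        (Slicing.slice X P t) f) (volume.restrict (Ioi (0 : ℝ))) ∧
    ∫⁻ t in Ioi (0 : ℝ),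
        Slicing.integralOn (Slicing.sphericalMeasure (EuclideanSpace ℝ (Fin n)) (m - 1))
          (Slicing.slice X P t) f
      ≤ Slicing.integralOn (Slicing.sphericalMeasure (EuclideanSpace ℝ (Fin n)) m) X f := by
  obtain ⟨k, rfl⟩ : ∃ k, m = k + 1 := ⟨m - 1, by omega⟩
  rw [Nat.add_sub_cancel]
  have : NeZero n := ⟨by omega⟩
  have : Nontrivial (EuclideanSpace ℝ (Fin n)) := inferInstance
  -- Only `f` on `X` is known to be measurable, so it is extended by zero; slices lie in `X` and do
  -- not see the extension.
  set F := X.indicator fun q => ENNReal.ofReal (f q) with hF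
  have hFm := (Slicing.isMeasurableOn_iff_of_nonneg hf0 hf.1).1 hf
  obtain ⟨h1, h2, h3⟩ := Slicing.slicing_ennreal P hP k hf.1 hX.ne hFm
  have hslice := (Slicing.ae_isCaratheodory_slice P hP k hf.1 hX.ne).1
  have hsub (t : ℝ) : Slicing.slice X (P : Set (EuclideanSpace ℝ (Fin n))) t ⊆ X := fun x hx => hx.1
  have hind (t : ℝ) : (Slicing.slice X (P : Set (EuclideanSpace ℝ (Fin n))) t).indicator F
      = (Slicing.slice X (P : Set (EuclideanSpace ℝ (Fin n))) t).indicator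
        fun q => ENNReal.ofReal (f q) := by
    rw [hF, indicator_indicator, inter_eq_self_of_subset_left (hsub t)]
  simp only [← hF, hind] at h1 h2 h3
  have heq : (fun t : ℝ => Slicing.integralOn
      (Slicing.sphericalMeasure (EuclideanSpace ℝ (Fin n)) k) (Slicing.slice X P t) f)
      =ᵐ[volume.restrict (Ioi (0 : ℝ))] fun t => Slicing.caratheodoryIntegral
        (Slicing.sphericalMeasure (EuclideanSpace ℝ (Fin n)) k)
        ((Slicing.slice X P t).indicator fun q => ENNReal.ofReal (f q)) := by
    filter_upwards [hslice] with t ht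
    exact Slicing.integralOn_eq_caratheodoryIntegral _ ht f
  refine ⟨?_, h2.congr heq.symm, ?_⟩
  · filter_upwards [h1, hslice] with t ht hst
    exact (Slicing.isMeasurableOn_iff_of_nonneg (fun x hx => hf0 x hx.1) hst).2 ht
  · rw [lintegral_congr_ae heq, Slicing.integralOn_eq_caratheodoryIntegral _ hf.1]
    rwa [hF, indicator_indicator, inter_self] at h3
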